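/- A sequence is a finite word $x_1x_2\dots x_n$. A repetition is a word of the form $\beta\beta$ with $\beta$ a nonempty word, and a word is called Thue (non-repetitive) if no block of consecutive terms of it is a repetition. For $d\ge 1$, a $d$-subsequence of $x_1\dots x_n$ is a sequence $x_i\,x_{i+d}\,x_{i+2d}\dots$ (all terms with index at most $n$), where $1\le i\le n$. A word is $k$-Thue if each of its $d$-subsequences with $1\le d\le k$ is Thue. Let $\lambda$ be the morphism on $\{1,2,3,4\}$ given by $$\lambda(1)=1234,\qquad \lambda(2)=2143,\qquad \lambda(3)=1243,\qquad \lambda(4)=2134,$$ and let $\lambda^0=1$ and $\lambda^t=\lambda(\lambda^{t-1})$ for $t\ge 1$, a word of length $4^t$. Let $\zeta$ be the circular sequence of the cyclic shifts of $5678$, that is, the periodic sequence $$5678\;6785\;7856\;8567\;5678\;6785\;\dots,$$ and let $\zeta_t$ be its prefix of length $4^t$. Let $\varphi_6^t$ be the wreathing of order $4$ of $\lambda^t$ and $\zeta_t$: the word obtained by writing alternately the consecutive blocks of length $4$ of $\lambda^t$ and of $\zeta_t$, beginning with $\lambda^t$ (for $t=0$, where both words have length $1$, this is read as $\varphi_6^0=1\,5$).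 For example, $\varphi_6^2 = 1234\;5678\;2143\;6785\;1243\;7856\;2134\;8567$. Then, for every integer $t\ge 0$, the sequence $\varphi_6^t$ is a $6$-Thue sequence of length $2\cdot 4^t$ over the alphabet $\{1,2,\dots,8\}$. Consequently, for every integer $n\ge 0$ there is a $6$-Thue sequence of length $n$ over an alphabet of $8$ symbols. -/

import Mathlib

namespace KThue

/-- A sequence is a repetition if it consists of two consecutive copies of a nonempty block. -/
def IsRepetition {α : Type*} (ρ : List α) : Prop :=
  ∃ b : List α, b ≠ [] ∧ ρ = b ++ b

/-- A sequence is Thue (non-repetitive) if no block of consecutive terms is a repetition. -/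
def IsThue {α : Type*} (w : List α) : Prop :=
  ∀ ρ : List α, ρ <:+: w → ¬ IsRepetition ρ

/-- The `d`-subsequence `x_i x_{i+d} x_{i+2d} …` of `w` (positions counted from `0`), for `d ≥ 1`.
Positions past the end of `w` contribute no term. -/
def dSubsequence {α : Type*} (d i : ℕ) (w : List α) : List α :=
  (List.range w.length).filterMap fun j => w[i + j * d]?

/-- `w` is `k`-Thue if each of its `d`-subsequences, for `1 ≤ d ≤ k`, is Thue. -/
def IsKThue {α : Type*} (k : ℕ) (w : List α) : Prop :=
  ∀ d : ℕ, 1 ≤ d → d ≤ k → ∀ i : ℕ, i < w.length → IsThue (dSubsequence d i w)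

/-- The circular sequence of `φ`: the blocks `φ^0 φ^1 … φ^{ℓ-1}` (all the cyclic shifts of `φ`,
where `ℓ` is the length of `φ`), the whole repeated `n` times. -/
def circular {α : Type*} (φ : List α) (n : ℕ) : List α :=
  (List.replicate n ((List.range φ.length).flatMap fun i => φ.rotate i)).flatten

/-- Sequence wreathing of order `ℓ` of two sequences of the same length: the consecutive blocks of
length `ℓ` of `u` and of `v` are written alternately, starting with `u`.
If `ℓ` does not divide the common length, then the last block of each of them is shorter. -/
def wreath {α : Type*} (ℓ : ℕ) (u v : List α) : List α :=
  (List.range ((u.length + ℓ - 1) / ℓ)).flatMap fun i =>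
    (u.drop (i * ℓ)).take ℓ ++ (v.drop (i * ℓ)).take ℓ

/-- The morphism `λ` on the alphabet `{1, 2, 3, 4}`; the last line is never used, since
only words over this alphabet occur. -/
def lam : ℕ → List ℕ
  | 1 => [1, 2, 3, 4]
  | 2 => [2, 1, 4, 3]
  | 3 => [1, 2, 4, 3]
  | 4 => [2, 1, 3, 4]
  | _ => []

/-- The sequence `λ^t`, of length `4 ^ t`: the `t`-th iterate of the morphism on the symbol `1`. -/
def lamSeq : ℕ → List ℕ
  | 0 => [1]
  | t + 1 => (lamSeq t).flatMap lam

/-- The sequence `φ_6^t`: the wreathing of order `4` of `λ^t` with the circular sequence of `5678`,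
the latter cut to the length `4 ^ t` of the former.  (The circular sequence has length
`16 * 4 ^ (t - 1) ≥ 4 ^ t`; the number of its rounds is irrelevant after the cut.) -/
def phi6 (t : ℕ) : List ℕ :=
  wreath 4 (lamSeq t) ((circular [5, 6, 7, 8] (4 ^ (t - 1))).take (4 ^ t))

end KThue

namespace KThue

/-! ### Sequences of the form `f 0, f 1, …, f (n - 1)` -/

/-! For `t ≥ 1` the words are prefixes of one infinite word `phiLimit`, so it suffices that no
progression with `d ≤ 6` reads a repetition there. The positions modulo 32 (`phiClass`) force the
shift `m * d` to be `32 * E`. One agreement inside a `λ`-block then makes its parent agree with the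
parent `4 * E` further on. For `d ≤ 4` every block is hit, giving agreement on a window of length `4
* E`, against `lamLimit_no_agree`. For `d = 5, 6` one of any two neighbouring blocks is hit, which
suffices to desubstitute once more, with shift `E` and window `E - 1`. -/

lemma flatMap_range_block {α : Type*} (F : ℕ → α) (k N : ℕ) :
    ((List.range N).flatMap fun i => (List.range k).map fun r => F (k * i + r)) =
      (List.range (k * N)).map F := by
  induction N with
  | zero => simp
  | succ N ih =>
    rw [List.range_succ, List.flatMap_append, ih, Nat.mul_succ, List.range_add]
    simp [Function.comp_def]

lemma take_drop_map_range {α : Type*} (F : ℕ → α) {a k n : ℕ} (h : a + k ≤ n) :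
    (((List.range n).map F).drop a).take k = (List.range k).map fun r => F (a + r) := by
  apply List.ext_getElem
  · simp; omega
  · intro j h₁ h₂
    simp

lemma dSubsequence_map_range {α : Type*} (F : ℕ → α) {d i n : ℕ} (hd : 1 ≤ d) (hi : i < n) :
    ∃ c, dSubsequence d i ((List.range n).map F) =
      (List.range c).map fun j => F (i + j * d) := by
  obtain ⟨c, hc⟩ : ∃ c, ∀ j, j < c ↔ i + j * d < n := by
    refine ⟨(n - i + d - 1) / d, fun j => ?_⟩
    rw [← Nat.succ_le_iff, Nat.le_div_iff_mul_le (by omega), Nat.succ_mul]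
    omega
  have hcn : c ≤ n := by
    by_contra! h
    have := (hc n).1 h
    nlinarith
  have key : ∀ N, (List.range N).filterMap
      (fun j => ((List.range n).map F)[i + j * d]?) =
      (List.range (min N c)).map fun j => F (i + j * d) := by
    intro N
    induction N with
    | zero => simp
    | succ N ih =>
      rw [List.range_succ, List.filterMap_append, ih]
      by_cases h : N < c
      · have h' := (hc N).1 h
        rw [min_eq_left h.le, min_eq_left (Nat.succ_le_of_lt h), List.range_succ]
        simp [h']
      · have h' : n ≤ i + N * d := by
          by_contra! h'
          exact h ((hc N).2 h')
        rw [min_eq_right (by omega), min_eq_right (by omega)]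
        simp [h']
  refine ⟨c, ?_⟩
  have := key n
  rw [min_eq_right hcn] at this
  simpa [dSubsequence] using this

/-- No progression of difference `d ≤ k` reads a repetition in the infinite sequence `F`. -/
def ProgressionFree {α : Type*} (k : ℕ) (F : ℕ → α) : Prop :=
  ∀ d, 1 ≤ d → d ≤ k → ∀ i m, 1 ≤ m →
    (∀ j < m, F (i + j * d) = F (i + j * d + m * d)) → False

lemma ProgressionFree.isKThue {α : Type*} {k : ℕ} {F : ℕ → α} (hF : ProgressionFree k F)
    (n : ℕ) : IsKThue k ((List.range n).map F) := by
  intro d hd hdk i hi ρ hρ hrep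
  obtain ⟨b, hb, rfl⟩ := hrep
  obtain ⟨c, hc⟩ := dSubsequence_map_range F hd (show i < n by simpa using hi)
  rw [hc] at hρ
  obtain ⟨s, u, hsu⟩ := hρ
  refine hF d hd hdk (i + s.length * d) b.length (List.length_pos_iff.2 hb) fun j hj => ?_
  have hlen := congrArg List.length hsu
  simp only [List.length_append, List.length_map, List.length_range] at hlen
  have h₁ := congrArg (fun l => l[s.length + j]?) hsu
  have h₂ := congrArg (fun l => l[s.length + (b.length + j)]?) hsu
  simp only [List.append_assoc, List.getElem?_append_right (Nat.le_add_right _ _),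
    Nat.add_sub_cancel_left, List.getElem?_append_left hj, List.getElem?_map,
    List.getElem?_range (show s.length + j < c by omega),
    List.getElem?_range (show s.length + (b.length + j) < c by omega), Option.map_some] at h₁ h₂
  have h := Option.some.inj (h₁.symm.trans h₂)
  convert h using 2 <;> ring

/-! ### The fixed point of the morphism -/

/-- The infinite word whose prefixes are the `lamSeq t`. -/
def lamLimit (n : ℕ) : ℕ :=
  if h : n = 0 then 1 else (lam (lamLimit (n / 4))).getD (n % 4) 0
decreasing_by omega

lemma lamLimit_zero : lamLimit 0 = 1 := by
  rw [lamLimit]; simp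

lemma lamLimit_eq (n : ℕ) : lamLimit n = (lam (lamLimit (n / 4))).getD (n % 4) 0 := by
  by_cases h : n = 0
  · subst h; simp [lamLimit_zero, lam]
  · rw [lamLimit]; simp [h]

lemma lamLimit_bounds (n : ℕ) : 1 ≤ lamLimit n ∧ lamLimit n ≤ 4 := by
  induction n using Nat.strong_induction_on with
  | _ n ih =>
    by_cases h : n = 0
    · subst h; simp [lamLimit_zero]
    · have := ih (n / 4) (by omega)
      rw [lamLimit_eq]
      have hr : n % 4 < 4 := Nat.mod_lt _ (by norm_num)
      generalize lamLimit (n / 4) = x at *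
      generalize n % 4 = r at *
      obtain ⟨h₁, h₂⟩ := this
      interval_cases x <;> interval_cases r <;> decide

/-- Each block is an ordering of `{1, 2}` followed by one of `{3, 4}`. The parent's two low bits fix
the two orders independently. -/
lemma lamLimit_cases (n : ℕ) :
    (n % 4 < 2 → lamLimit n ≤ 2 ∧ (lamLimit n + n + lamLimit (n / 4)) % 2 = 0) ∧
    (2 ≤ n % 4 → 3 ≤ lamLimit n ∧ (lamLimit n + n + lamLimit (n / 4) / 2) % 2 = 1) := by
  have hb := lamLimit_bounds (n / 4)
  rw [lamLimit_eq n]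
  have hr : n % 4 < 4 := Nat.mod_lt _ (by norm_num)
  generalize lamLimit (n / 4) = x at *
  obtain ⟨h₁, h₂⟩ := hb
  rcases (by omega : n % 4 = 0 ∨ n % 4 = 1 ∨ n % 4 = 2 ∨ n % 4 = 3) with h | h | h | h <;>
    rw [h] <;> interval_cases x <;> simp [lam] <;> omega

lemma half_eq_of_lamLimit_eq {n n' : ℕ} (h : lamLimit n = lamLimit n') :
    n / 2 % 2 = n' / 2 % 2 := by
  have := lamLimit_cases n
  have := lamLimit_cases n'
  omega

lemma lamLimit_ne_succ (n : ℕ) : lamLimit n ≠ lamLimit (n + 1) := by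
  intro h
  have := half_eq_of_lamLimit_eq h
  have := lamLimit_cases n
  have := lamLimit_cases (n + 1)
  have h4 : (n + 1) / 4 = n / 4 := by omega
  rw [h4] at this
  omega

/-- An agreement in the first half of two blocks determines the parity of the parents. -/
lemma parent_mod_two {q r E : ℕ} (hr : r < 2)
    (h : lamLimit (4 * q + r) = lamLimit (4 * q + r + 4 * E)) :
    lamLimit q % 2 = lamLimit (q + E) % 2 := by
  have h₁ := lamLimit_cases (4 * q + r)
  have h₂ := lamLimit_cases (4 * q + r + 4 * E)
  rw [show (4 * q + r) / 4 = q by omega] at h₁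
  rw [show (4 * q + r + 4 * E) / 4 = q + E by omega] at h₂
  omega

/-- An agreement in the second half of two blocks determines the second bit of the parents. -/
lemma parent_div_two {q r E : ℕ} (hr : 2 ≤ r) (hr' : r < 4)
    (h : lamLimit (4 * q + r) = lamLimit (4 * q + r + 4 * E)) :
    lamLimit q / 2 % 2 = lamLimit (q + E) / 2 % 2 := by
  have h₁ := lamLimit_cases (4 * q + r)
  have h₂ := lamLimit_cases (4 * q + r + 4 * E)
  rw [show (4 * q + r) / 4 = q by omega] at h₁
  rw [show (4 * q + r + 4 * E) / 4 = q + E by omega] at h₂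
  omega

lemma parent_eq_of_two {q r s E : ℕ} (hr : r < 2) (hs : 2 ≤ s) (hs' : s < 4)
    (h : lamLimit (4 * q + r) = lamLimit (4 * q + r + 4 * E))
    (h' : lamLimit (4 * q + s) = lamLimit (4 * q + s + 4 * E)) :
    lamLimit q = lamLimit (q + E) := by
  have := parent_mod_two hr h
  have := parent_div_two hs hs' h'
  have := lamLimit_bounds q
  have := lamLimit_bounds (q + E)
  omega

/-- Within `{1, 2}` or within `{3, 4}`, either of the two bits identifies the letter. -/
lemma parent_eq_of_half {q r E : ℕ} (hr : r < 4) (hE : q / 2 % 2 = (q + E) / 2 % 2)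
    (h : lamLimit (4 * q + r) = lamLimit (4 * q + r + 4 * E)) :
    lamLimit q = lamLimit (q + E) := by
  have h₁ := lamLimit_cases q
  have h₂ := lamLimit_cases (q + E)
  have := lamLimit_bounds q
  have := lamLimit_bounds (q + E)
  by_cases hr2 : r < 2
  · have := parent_mod_two hr2 h
    omega
  · have := parent_div_two (by omega) hr h
    omega

lemma four_dvd_of_agree {F a W : ℕ} (hW : 2 ≤ W)
    (h : ∀ n, a ≤ n → n < a + W → lamLimit n = lamLimit (n + F)) : F % 4 = 0 := by
  have h₁ := half_eq_of_lamLimit_eq (h a le_rfl (by omega))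
  have h₂ := half_eq_of_lamLimit_eq (h (a + 1) (by omega) (by omega))
  omega

/-- The fixed point does not agree with its shift by `F` on a window longer than `3 F / 4`. -/
theorem lamLimit_no_agree (F : ℕ) : ∀ a W, 1 ≤ F → 3 * F < 4 * W →
    (∀ n, a ≤ n → n < a + W → lamLimit n = lamLimit (n + F)) → False := by
  induction F using Nat.strong_induction_on with
  | _ F ih =>
  intro a W hF hW h
  by_cases hF1 : F = 1
  · subst hF1
    exact lamLimit_ne_succ a (h a le_rfl (by omega))
  obtain ⟨E, rfl⟩ : ∃ E, F = 4 * E :=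
    ⟨F / 4, by have := four_dvd_of_agree (by omega) h; omega⟩
  have both : ∀ q, a ≤ 4 * q + 1 → 4 * q + 2 < a + W → lamLimit q = lamLimit (q + E) :=
    fun q h₁ h₂ => parent_eq_of_two (r := 1) (s := 2) (by omega) (by omega) (by omega)
      (h _ h₁ (by omega)) (h _ (by omega) h₂)
  by_cases hE : E % 4 = 0
  · refine ih E (by omega) (a / 4) ((a + W - 1) / 4 - a / 4 + 1) (by omega) (by omega) ?_
    intro q hq hq'
    refine parent_eq_of_half (r := max a (4 * q) - 4 * q) (by omega) (by omega) (h _ ?_ ?_) <;>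
      omega
  by_cases hE1 : E = 1
  · subst hE1
    -- Only in this case may a window of length 4 miss the middle pair of every block.
    by_cases ha : a % 4 = 2
    · obtain ⟨c, rfl⟩ : ∃ c, a = 4 * c + 2 := ⟨a / 4, by omega⟩
      by_cases hc : c % 2 = 0
      · exact lamLimit_ne_succ c (parent_eq_of_half (r := 2) (by omega) (by omega)
          (h _ (by omega) (by omega)))
      · exact lamLimit_ne_succ (c + 1) (parent_eq_of_half (r := 0) (by omega) (by omega)
          (h _ (by omega) (by omega)))
    · exact lamLimit_ne_succ _ (both ((a + 2) / 4) (by omega) (by omega))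
  have h₁ := half_eq_of_lamLimit_eq (both ((a + 2) / 4) (by omega) (by omega))
  by_cases hE2 : E % 4 = 2
  · omega
  have h₂ := half_eq_of_lamLimit_eq (both ((a + 2) / 4 + 1) (by omega) (by omega))
  omega

/-! ### The wreathed infinite word -/

/-- The infinite word whose prefixes are the `phi6 t` with `t ≥ 1`. -/
def phiLimit (p : ℕ) : ℕ :=
  if p % 8 < 4 then lamLimit (4 * (p / 8) + p % 8) else 5 + (p / 8 + p % 8) % 4

lemma phiLimit_bounds (p : ℕ) : 1 ≤ phiLimit p ∧ phiLimit p ≤ 8 := by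
  unfold phiLimit
  have := lamLimit_bounds (4 * (p / 8) + p % 8)
  split_ifs <;> omega

/-- The information on `phiLimit p` that is determined by `p` modulo `32`. -/
def phiClass (p : ℕ) : ℕ :=
  if p % 8 < 4 then p % 8 / 2 else 5 + (p / 8 + p % 8) % 4

lemma phiClass_mod (p : ℕ) : phiClass (p % 32) = phiClass p := by
  unfold phiClass
  have h₁ : p % 32 % 8 = p % 8 := by omega
  have h₂ : (p % 32 / 8 + p % 8) % 4 = (p / 8 + p % 8) % 4 := by omega
  rw [h₁, h₂]

lemma phiClass_eq_of_phiLimit_eq {p p' : ℕ} (h : phiLimit p = phiLimit p') :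
    phiClass p = phiClass p' := by
  unfold phiLimit at h
  unfold phiClass
  have h₁ := lamLimit_bounds (4 * (p / 8) + p % 8)
  have h₂ := lamLimit_bounds (4 * (p' / 8) + p' % 8)
  by_cases hp : p % 8 < 4 <;> by_cases hp' : p' % 8 < 4 <;>
    simp only [hp, hp', if_true, if_false] at h ⊢
  · have := half_eq_of_lamLimit_eq h
    omega
  · omega
  · omega
  · exact h

/-- Only `m` modulo 32 matters, as the first `m % 32` comparisons are available. The exception is
genuine: neighbours in one half of a block share a class. -/
lemma phiClass_progression :
    ∀ d < 7, 1 ≤ d → ∀ m < 32, m * d % 32 = 0 ∨ (d = 1 ∧ m = 1) ∨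
      ∀ i < 32, ∃ j < m, phiClass ((i + j * d) % 32) ≠ phiClass ((i + j * d + m * d) % 32) := by
  decide +kernel

lemma phiClass_shift_one :
    ∀ i < 32, ∃ j < 2, phiClass ((i + j) % 32) ≠ phiClass ((i + j + 1) % 32) := by
  decide +kernel

lemma phiLimit_ne_succ (p : ℕ) : phiLimit p ≠ phiLimit (p + 1) := by
  intro h
  have hc := phiClass_eq_of_phiLimit_eq h
  unfold phiLimit at h
  unfold phiClass at hc
  by_cases hp : p % 8 < 4 <;> by_cases hp' : (p + 1) % 8 < 4 <;>
    simp only [hp, hp', if_true, if_false] at h hc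
  · rw [show 4 * ((p + 1) / 8) + (p + 1) % 8 = 4 * (p / 8) + p % 8 + 1 by omega] at h
    exact lamLimit_ne_succ _ h
  all_goals omega

lemma shift_dvd_of_phiLimit_agree {d i m : ℕ} (hd : 1 ≤ d) (hd6 : d ≤ 6) (hm : 1 ≤ m)
    (h : ∀ j < m, phiLimit (i + j * d) = phiLimit (i + j * d + m * d)) : m * d % 32 = 0 := by
  have hc : ∀ j < m, phiClass ((i % 32 + j * d) % 32) =
      phiClass ((i % 32 + j * d + m % 32 * d) % 32) := by
    intro j hj
    have := phiClass_eq_of_phiLimit_eq (h j hj)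
    rw [← phiClass_mod, ← phiClass_mod (_ + _ + _)] at this
    simpa [Nat.add_mod, Nat.mul_mod] using this
  rcases phiClass_progression d (by omega) hd (m % 32) (Nat.mod_lt _ (by norm_num)) with
    h0 | ⟨rfl, h1⟩ | h2
  · simpa [Nat.mul_mod] using h0
  · by_cases hm1 : m = 1
    · subst hm1
      have := h 0 (by omega)
      exact absurd (by simpa using this) (phiLimit_ne_succ i)
    · obtain ⟨j, hj, hne⟩ := phiClass_shift_one (i % 32) (Nat.mod_lt _ (by norm_num))
      have := hc j (by omega)
      rw [h1] at this
      exact absurd (by simpa using this) hne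
  · obtain ⟨j, hj, hne⟩ := h2 (i % 32) (Nat.mod_lt _ (by norm_num))
    exact absurd (hc j (hj.trans_le (Nat.mod_le _ _))) hne

lemma lamLimit_agree_of_phiLimit_agree {p q r E : ℕ} (hr : r < 4) (hp : p = 8 * q + r)
    (h : phiLimit p = phiLimit (p + 32 * E)) :
    lamLimit (4 * q + r) = lamLimit (4 * q + r + 4 * (4 * E)) := by
  subst hp
  unfold phiLimit at h
  rw [if_pos (by omega), if_pos (by omega)] at h
  convert h using 2 <;> omega

lemma lamLimit_agree_parent {p q E : ℕ} (hp : 8 * q ≤ p) (hp' : p < 8 * q + 4)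
    (h : phiLimit p = phiLimit (p + 32 * E)) : lamLimit q = lamLimit (q + 4 * E) :=
  parent_eq_of_half (r := p - 8 * q) (by omega) (by omega)
    (lamLimit_agree_of_phiLimit_agree (by omega) (by omega) h)

theorem phiLimit_progressionFree : ProgressionFree 6 phiLimit := by
  intro d hd hd6 i m hm h
  obtain ⟨E, hE⟩ : ∃ E, m * d = 32 * E :=
    ⟨m * d / 32, by have := shift_dvd_of_phiLimit_agree hd hd6 hm h; omega⟩
  have hE1 : 1 ≤ E := by
    have : 0 < m * d := Nat.mul_pos hm hd
    omega
  rw [hE] at h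
  by_cases hd4 : d ≤ 4
  · refine lamLimit_no_agree (4 * E) ((i + 4) / 8) (4 * E) (by omega) (by omega) ?_
    intro q hq hq'
    obtain ⟨j, hj, h₁, h₂⟩ : ∃ j < m, 8 * q ≤ i + j * d ∧ i + j * d < 8 * q + 4 := by
      -- The first term from `8 * q` on; if the block starts before `i`, truncation gives `j = 0`.
      refine ⟨(8 * q - i + d - 1) / d, ?_⟩
      interval_cases d <;> omega
    exact lamLimit_agree_parent h₁ h₂ (h j hj)
  · have hit : ∀ B, i ≤ B → B + 12 ≤ i + 32 * E → ∃ j < m,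
        (B ≤ i + j * d ∧ i + j * d < B + 4) ∨ (B + 8 ≤ i + j * d ∧ i + j * d < B + 12) := by
      intro B hB hB'
      obtain ⟨j, hj⟩ : ∃ j, j = (B - i + d - 1) / d := ⟨_, rfl⟩
      by_cases hs : i + j * d < B + 4
      · refine ⟨j, ?_⟩
        interval_cases d <;> omega
      -- The term `j` is at `B + 4` or `B + 5`, so the next falls in the second block.
      · refine ⟨j + 1, ?_⟩
        interval_cases d <;> omega
    have agree : ∀ Q, (i + 31) / 32 ≤ Q → Q < (i + 31) / 32 + (E - 1) →
        lamLimit Q = lamLimit (Q + E) := by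
      intro Q hQ hQ'
      obtain ⟨j, hj, hjB⟩ := hit (32 * Q) (by omega) (by omega)
      obtain ⟨k, hk, hkB⟩ := hit (32 * Q + 16) (by omega) (by omega)
      refine parent_eq_of_two (r := (i + j * d) / 8 - 4 * Q) (s := (i + k * d) / 8 - 4 * Q)
        (by omega) (by omega) (by omega) ?_ ?_
      · exact lamLimit_agree_parent (by omega) (by omega) (h j hj)
      · exact lamLimit_agree_parent (by omega) (by omega) (h k hk)
    by_cases hE4 : 4 < E
    · exact lamLimit_no_agree E _ _ (by omega) (by omega) agree
    -- `5 ∣ E` or `3 ∣ E`, according to `d`; the window still has length 2.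
    · have h3 : E = 3 := by interval_cases d <;> omega
      have := four_dvd_of_agree (by omega) agree
      omega

/-! ### The finite words as prefixes -/

lemma lam_lamLimit (n : ℕ) :
    lam (lamLimit n) = (List.range 4).map fun r => lamLimit (4 * n + r) := by
  have hr : ∀ r < 4, lamLimit (4 * n + r) = (lam (lamLimit n)).getD r 0 := by
    intro r hr
    rw [lamLimit_eq, show (4 * n + r) / 4 = n by omega, show (4 * n + r) % 4 = r by omega]
  obtain ⟨h₁, h₂⟩ := lamLimit_bounds n
  rw [show List.range 4 = [0, 1, 2, 3] from rfl]
  simp only [List.map_cons, List.map_nil, hr 0 (by omega), hr 1 (by omega), hr 2 (by omega),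
    hr 3 (by omega)]
  interval_cases lamLimit n <;> rfl

lemma lamSeq_eq (t : ℕ) : lamSeq t = (List.range (4 ^ t)).map lamLimit := by
  induction t with
  | zero => simp [lamSeq, lamLimit_zero]
  | succ t ih =>
    rw [lamSeq, ih, List.flatMap_map, pow_succ', ← flatMap_range_block]
    simp only [lam_lamLimit]

lemma circular_eq (n : ℕ) : circular [5, 6, 7, 8] n =
    (List.range (16 * n)).map fun k => 5 + (k / 4 + k % 4) % 4 := by
  rw [← flatMap_range_block]
  have h : ∀ i, ((List.range 16).map fun r =>
      5 + ((16 * i + r) / 4 + (16 * i + r) % 4) % 4) =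
      (List.range [5, 6, 7, 8].length).flatMap fun i => [5, 6, 7, 8].rotate i := by
    intro i
    trans (List.range 16).map fun r => 5 + (r / 4 + r % 4) % 4
    · refine List.map_congr_left fun r _ => ?_
      omega
    · decide
  simp only [h, circular]
  induction n with
  | zero => rfl
  | succ n ih =>
    rw [List.replicate_succ', List.flatten_append, ih, List.range_succ, List.flatMap_append]
    simp

lemma wreath_map_range {α : Type*} (f g : ℕ → α) (N : ℕ) :
    wreath 4 ((List.range (4 * N)).map f) ((List.range (4 * N)).map g) =
      (List.range (8 * N)).map fun p =>
        if p % 8 < 4 then f (4 * (p / 8) + p % 8) else g (4 * (p / 8) + p % 8 - 4) := by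
  rw [← flatMap_range_block _ 8 N]
  unfold wreath
  rw [List.length_map, List.length_range, show (4 * N + 4 - 1) / 4 = N by omega,
    List.flatMap_def, List.flatMap_def]
  congr 1
  refine List.map_congr_left fun i hi => ?_
  have hi := List.mem_range.1 hi
  rw [take_drop_map_range f (by omega), take_drop_map_range g (by omega),
    show List.range 8 = List.range (4 + 4) from rfl, List.range_add, List.map_append,
    List.map_map]
  congr 1 <;> refine List.map_congr_left fun r hr => ?_ <;> have hr := List.mem_range.1 hr
  · rw [if_pos (by omega)]
    congr 1
    omega
  · rw [Function.comp_apply, if_neg (by omega)]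
    congr 1
    omega

lemma phi6_zero : phi6 0 = (List.range 2).map fun p => 1 + 4 * p := by decide

lemma phi6_succ (t : ℕ) : phi6 (t + 1) = (List.range (2 * 4 ^ (t + 1))).map phiLimit := by
  unfold phi6
  rw [Nat.add_sub_cancel, lamSeq_eq, circular_eq, ← List.map_take, List.take_range,
    show min (4 ^ (t + 1)) (16 * 4 ^ t) = 4 * 4 ^ t by omega, pow_succ', wreath_map_range,
    show 2 * (4 * 4 ^ t) = 8 * 4 ^ t by omega]
  refine List.map_congr_left fun p _ => ?_
  unfold phiLimit
  split_ifs <;> omega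

lemma progressionFree_of_injective {α : Type*} {F : ℕ → α} (hF : Function.Injective F) (k : ℕ) :
    ProgressionFree k F := by
  intro d hd _ i m hm h
  have := hF (h 0 hm)
  have : 0 < m * d := Nat.mul_pos hm hd
  omega

end KThue

theorem mainTheorem2 :
    (∀ t : ℕ,
      (KThue.phi6 t).length = 2 * 4 ^ t ∧
      (∀ x ∈ KThue.phi6 t, x ∈ Finset.Icc 1 8) ∧
      KThue.IsKThue 6 (KThue.phi6 t)) ∧
    (∀ n : ℕ, ∃ w : List (Fin 8), w.length = n ∧ KThue.IsKThue 6 w) := by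
  constructor
  · rintro (_ | t)
    · refine ⟨by decide, by decide, ?_⟩
      rw [KThue.phi6_zero]
      exact (KThue.progressionFree_of_injective (fun a b h => by simpa using h) 6).isKThue 2
    · rw [KThue.phi6_succ]
      refine ⟨by simp, fun x hx => ?_, KThue.phiLimit_progressionFree.isKThue _⟩
      obtain ⟨p, -, rfl⟩ := List.mem_map.1 hx
      exact Finset.mem_Icc.2 (KThue.phiLimit_bounds p)
  · intro n
    -- Reduction modulo 8 is injective on the letters 1 to 8.
    refine ⟨(List.range n).map fun p => Fin.ofNat 8 (KThue.phiLimit p), by simp, ?_⟩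
    refine KThue.ProgressionFree.isKThue (fun d hd hd6 i m hm h => ?_) n
    refine KThue.phiLimit_progressionFree d hd hd6 i m hm fun j hj => ?_
    have h₁ := KThue.phiLimit_bounds (i + j * d)
    have h₂ := KThue.phiLimit_bounds (i + j * d + m * d)
    have := congrArg Fin.val (h j hj)
    simp only [Fin.ofNat] at this
    omega
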